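/- Let $X$ and $Y$ be (real or complex) Banach spaces. Suppose that $X$ has a $1$-unconditional basis, i.e. a Schauder basis $(e_n)_{n\in\mathbb N}$ such that, for all signs $\epsilon_n=\pm1$, the series $\sum_n\epsilon_n\alpha_ne_n$ converges whenever $\sum_n\alpha_ne_n$ converges, and such that $\sup\{\|\sum_n\epsilon_n\alpha_ne_n\| : \|\sum_n\alpha_ne_n\|=1,\ \epsilon_n=\pm1\}=1$. Suppose that $Y$ has property asymptotic (P), i.e. for every sequence $(y_n)$ in $Y$ that converges weakly to $0$ and satisfies $\operatorname{diam}_a(y_n):=\lim_{n\to\infty}\sup_{k,l\ge n}\|y_k-y_l\|>0$, one has $\liminf_{n\to\infty}\|y_n\|<\operatorname{diam}_a(y_n)$. Let $\|\cdot\|_Z$ be a strictly monotone norm on $\mathbb R^2$, i.e. $\|(x_1,y_1)\|_Z<\|(x_2,y_2)\|_Z$ whenever $0\le x_1\le x_2$, $0\le y_1<y_2$ or $0\le x_1<x_2$, $0\le y_1\le y_2$. Then the direct sum $X\oplus_ZY$, that is $X\times Y$ with the norm $\|(x,y)\|=\|(\|x\|,\|y\|)\|_Z$, has the weak fixed point property: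 for every nonempty weakly compact convex set $C\subset X\oplus_ZY$, every mapping $T:C\to C$ with $\|Tu-Tv\|\le\|u-v\|$ for all $u,v\in C$ has a fixed point. -/

import Mathlib

open Filter Topology

noncomputable section

/-- A nonexpansive self-map of every nonempty weakly compact convex set has a fixed point:
the weak fixed point property of the normed space `E` over `𝕜` (real or complex). -/
def HasWeakFixedPointProperty (𝕜 : Type*) (E : Type*) [RCLike 𝕜] [NormedAddCommGroup E]
    [NormedSpace ℝ E] [NormedSpace 𝕜 E] : Prop :=
  ∀ C : Set E, C.Nonempty → IsCompact (toWeakSpace 𝕜 E '' C) → Convex ℝ C →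
    ∀ T : C → C, LipschitzWith 1 T → ∃ x : C, T x = x

/-- The sequence `y` converges weakly to `0`. -/
def IsWeaklyNull (𝕜 : Type*) {E : Type*} [RCLike 𝕜] [NormedAddCommGroup E] [NormedSpace 𝕜 E]
    (y : ℕ → E) : Prop :=
  ∀ f : StrongDual 𝕜 E, Tendsto (fun n => f (y n)) atTop (𝓝 0)

/-- `d` is the asymptotic diameter `lim_n sup {‖y k - y l‖ : k, l ≥ n}` of the (bounded)
sequence `y`. -/
def IsAsymptoticDiam {E : Type*} [NormedAddCommGroup E] (y : ℕ → E) (d : ℝ) : Prop :=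
  Tendsto (fun n => Metric.diam (y '' Set.Ici n)) atTop (𝓝 d)

/-- Property asymptotic (P): `liminf ‖y n‖` is smaller than the asymptotic diameter of `y` for
every weakly null sequence `y` whose asymptotic diameter is positive. (Weakly null sequences are
bounded, so the asymptotic diameter always exists.) -/
def HasPropertyAsymptoticP (𝕜 : Type*) (E : Type*) [RCLike 𝕜] [NormedAddCommGroup E]
    [NormedSpace 𝕜 E] : Prop :=
  ∀ y : ℕ → E, IsWeaklyNull 𝕜 y → ∀ d : ℝ, IsAsymptoticDiam y d → 0 < d →
    liminf (fun n => ‖y n‖) atTop < d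

/-- A Schauder basis `b` is unconditional: if `∑ α n • b n` converges then `∑ ε n • α n • b n`
converges for all signs `ε n = ±1`. The series are limits of partial sums. -/
def IsUnconditionalBasis {𝕜 : Type*} {E : Type*} [RCLike 𝕜] [NormedAddCommGroup E]
    [NormedSpace 𝕜 E] (b : SchauderBasis 𝕜 E) : Prop :=
  ∀ ε : ℕ → 𝕜, (∀ n, ε n = 1 ∨ ε n = -1) → ∀ α : ℕ → 𝕜,
    Summable (fun n => α n • b n) (SummationFilter.conditional ℕ) →
      Summable (fun n => ε n • α n • b n) (SummationFilter.conditional ℕ)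

/-- `l` is the unconditional constant of `b`: the supremum of `‖∑ ε n • α n • b n‖` over all signs
`ε n = ±1` and all `α` with `‖∑ α n • b n‖ = 1`. -/
def IsUnconditionalConstant {𝕜 : Type*} {E : Type*} [RCLike 𝕜] [NormedAddCommGroup E]
    [NormedSpace 𝕜 E] (b : SchauderBasis 𝕜 E) (l : ℝ) : Prop :=
  IsLUB {r : ℝ | ∃ (ε α : ℕ → 𝕜) (x y : E), (∀ n, ε n = 1 ∨ ε n = -1) ∧
    HasSum (fun n => α n • b n) x (SummationFilter.conditional ℕ) ∧ ‖x‖ = 1 ∧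
    HasSum (fun n => ε n • α n • b n) y (SummationFilter.conditional ℕ) ∧ r = ‖y‖} l

/-- `E` has a `1`-unconditional basis. -/
def HasOneUnconditionalBasis (𝕜 : Type*) (E : Type*) [RCLike 𝕜] [NormedAddCommGroup E]
    [NormedSpace 𝕜 E] : Prop :=
  ∃ b : SchauderBasis 𝕜 E, IsUnconditionalBasis b ∧ IsUnconditionalConstant b 1

/-- A strictly monotone norm on the plane `ℝ²`. -/
structure StrictlyMonotoneNorm extends Seminorm ℝ (ℝ × ℝ) where
  eq_zero_of_map_eq_zero' : ∀ p : ℝ × ℝ, toFun p = 0 → p = 0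
  strictMono_left : ∀ x₁ x₂ y₁ y₂ : ℝ, 0 ≤ x₁ → x₁ < x₂ → 0 ≤ y₁ → y₁ ≤ y₂ →
    toFun (x₁, y₁) < toFun (x₂, y₂)
  strictMono_right : ∀ x₁ x₂ y₁ y₂ : ℝ, 0 ≤ x₁ → x₁ ≤ x₂ → 0 ≤ y₁ → y₁ < y₂ →
    toFun (x₁, y₁) < toFun (x₂, y₂)

theorem StrictlyMonotoneNorm.mono (Z : StrictlyMonotoneNorm) {x₁ x₂ y₁ y₂ : ℝ} (hx₁ : 0 ≤ x₁)
    (hx : x₁ ≤ x₂) (hy₁ : 0 ≤ y₁) (hy : y₁ ≤ y₂) :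
    Z.toSeminorm (x₁, y₁) ≤ Z.toSeminorm (x₂, y₂) := by
  rcases hx.eq_or_lt with rfl | hx
  · rcases hy.eq_or_lt with rfl | hy
    · exact le_rfl
    · exact (Z.strictMono_right _ _ _ _ hx₁ le_rfl hy₁ hy).le
  · exact (Z.strictMono_left _ _ _ _ hx₁ hx hy₁ hy).le

/-- The direct sum `X ⊕_Z Y`: the vector space `X × Y` with the norm
`‖(x, y)‖ = ‖(‖x‖, ‖y‖)‖_Z`. -/
def ZSum (_Z : StrictlyMonotoneNorm) (X Y : Type*) : Type _ := X × Y

namespace ZSum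

instance instAddCommGroup (Z : StrictlyMonotoneNorm) (X Y : Type*) [AddCommGroup X]
    [AddCommGroup Y] : AddCommGroup (ZSum Z X Y) :=
  inferInstanceAs (AddCommGroup (X × Y))

instance instModule (Z : StrictlyMonotoneNorm) (𝕜 X Y : Type*) [Semiring 𝕜] [AddCommGroup X]
    [AddCommGroup Y] [Module 𝕜 X] [Module 𝕜 Y] : Module 𝕜 (ZSum Z X Y) :=
  inferInstanceAs (Module 𝕜 (X × Y))

/-- The norm of `X ⊕_Z Y`. -/
def addGroupNorm (Z : StrictlyMonotoneNorm) (X Y : Type*) [NormedAddCommGroup X]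
    [NormedAddCommGroup Y] : AddGroupNorm (ZSum Z X Y) where
  toFun v := Z.toSeminorm (‖v.1‖, ‖v.2‖)
  map_zero' := by
    change Z.toSeminorm (‖(0 : X)‖, ‖(0 : Y)‖) = 0
    rw [norm_zero, norm_zero]
    exact map_zero Z.toSeminorm
  add_le' v w := by
    change Z.toSeminorm (‖v.1 + w.1‖, ‖v.2 + w.2‖) ≤ _
    refine (Z.mono (norm_nonneg _) (norm_add_le _ _) (norm_nonneg _) (norm_add_le _ _)).trans ?_
    exact map_add_le_add Z.toSeminorm (‖v.1‖, ‖v.2‖) (‖w.1‖, ‖w.2‖)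
  neg' v := by
    change Z.toSeminorm (‖-v.1‖, ‖-v.2‖) = _
    rw [norm_neg, norm_neg]
  eq_zero_of_map_eq_zero' v hv := by
    have h := Z.eq_zero_of_map_eq_zero' _ hv
    have h1 : ‖v.1‖ = 0 := congrArg Prod.fst h
    have h2 : ‖v.2‖ = 0 := congrArg Prod.snd h
    exact Prod.ext (norm_eq_zero.1 h1) (norm_eq_zero.1 h2)

instance instNormedAddCommGroup (Z : StrictlyMonotoneNorm) (X Y : Type*) [NormedAddCommGroup X]
    [NormedAddCommGroup Y] : NormedAddCommGroup (ZSum Z X Y) :=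
  (addGroupNorm Z X Y).toNormedAddCommGroup

theorem norm_def (Z : StrictlyMonotoneNorm) (X Y : Type*) [NormedAddCommGroup X]
    [NormedAddCommGroup Y] (v : ZSum Z X Y) : ‖v‖ = Z.toSeminorm (‖v.1‖, ‖v.2‖) := rfl

instance instNormedSpace (Z : StrictlyMonotoneNorm) (𝕜 X Y : Type*) [NormedField 𝕜]
    [NormedAddCommGroup X] [NormedAddCommGroup Y] [NormedSpace 𝕜 X] [NormedSpace 𝕜 Y] :
    NormedSpace 𝕜 (ZSum Z X Y) where
  norm_smul_le c v := by
    change Z.toSeminorm (‖c • v.1‖, ‖c • v.2‖) ≤ ‖c‖ * Z.toSeminorm (‖v.1‖, ‖v.2‖)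
    have h := map_smul_eq_mul Z.toSeminorm ‖c‖ (‖v.1‖, ‖v.2‖)
    rw [norm_norm, Prod.smul_mk, smul_eq_mul, smul_eq_mul] at h
    rw [norm_smul, norm_smul, h]

end ZSum

end

/-!
Suppose that a nonexpansive self-map `T` of a weakly compact convex set is given. Zorn's lemma
yields a minimal invariant set `C`; let `d` be its diameter. Every point of `C` is diametral, and
the Goebel–Karlovitz lemma (`IsMinimalInvariant.exists_forall_lt_norm_sub`) says that almost fixed
points of `T` are almost at distance `d` from any given point of `C`. It has to be shown that
`d = 0`.

Take almost fixed points `u n` that converge weakly to `p ∈ C`. Then `‖u n - p‖ → d`, while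
`‖u n - u m‖ ≤ d`. Asymptotically `‖u n - u m‖` is, in each component, at least as large as
`‖u m - p‖`, so strict monotonicity of the norm on the plane makes the second components of
`u n - p` have mutual distances no larger than the limit of their norms. Property asymptotic (P)
forces that limit to be `0` (`ZSum.exists_subseq_tendsto_snd`).

The first components are treated by Lin's argument, here without ultrapowers. For a small `t > 0`
let `J q` be the solution `w` of `w = (1 - t) • T w + t • q`. The map `J` is nonexpansive, its
values are almost fixed by `T`, and it hardly moves the `u n` with large `n`. Choose `u n` and
`u m` such that the first components of `u n - p` and `u m - p` are almost supported on disjoint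
blocks on which that of `J p - p` is small, and let `w = J ((u n + u m) / 2)`. Changing signs on one
block shows that `‖(u n + u m) / 2 - p‖` is almost at most `d / 2`, so `w` is almost within `d / 2`
of each of `J p`, `u n` and `u m`. With `P` and `Q` the coordinate projections onto the two blocks,
`2 x = (P + Q) x + (x - P x) + (x - Q x)` bounds `2 ‖w - p‖` by the sum of these three distances, up
to a small error (`ZSum.two_mul_norm_le`). Hence `‖w - p‖` is almost at most `3 d / 4`, although `w`
is almost fixed and so has distance almost `d` from `p`. Thus `d = 0`.
-/

/-! ### Weakly compact convex sets -/

section WeaklyCompact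

variable {𝕜 E : Type*} [RCLike 𝕜] [NormedAddCommGroup E] [NormedSpace 𝕜 E]

theorem isClosed_of_isCompact_toWeakSpace {C : Set E} (hC : IsCompact (toWeakSpace 𝕜 E '' C)) :
    IsClosed C := by
  have h : IsClosed ((toWeakSpaceCLM 𝕜 E) ⁻¹' (toWeakSpace 𝕜 E '' C)) :=
    hC.isClosed.preimage (toWeakSpaceCLM 𝕜 E).continuous
  have h2 : (toWeakSpaceCLM 𝕜 E) ⁻¹' (toWeakSpace 𝕜 E '' C) = C :=
    Set.preimage_image_eq C (toWeakSpace 𝕜 E).injective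
  rwa [h2] at h

theorem isClosed_toWeakSpace_image [NormedSpace ℝ E] [IsScalarTower ℝ 𝕜 E] {D : Set E}
    (hD : IsClosed D) (hconv : Convex ℝ D) : IsClosed (toWeakSpace 𝕜 E '' D) := by
  have h := hconv.toWeakSpace_closure 𝕜
  rw [hD.closure_eq] at h
  exact isClosed_of_closure_subset h.ge

theorem isCompact_toWeakSpace_of_subset [NormedSpace ℝ E] [IsScalarTower ℝ 𝕜 E] {C D : Set E}
    (hC : IsCompact (toWeakSpace 𝕜 E '' C)) (hDC : D ⊆ C) (hD : IsClosed D)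
    (hconv : Convex ℝ D) : IsCompact (toWeakSpace 𝕜 E '' D) :=
  hC.of_isClosed_subset (isClosed_toWeakSpace_image hD hconv) (Set.image_mono hDC)

theorem continuous_strongDual_toWeakSpace_symm (f : StrongDual 𝕜 E) :
    Continuous fun w : WeakSpace 𝕜 E => f ((toWeakSpace 𝕜 E).symm w) :=
  WeakBilin.eval_continuous (topDualPairing 𝕜 E).flip f

/-- Weakly compact sets are bounded, by the uniform boundedness principle in the dual. -/
theorem isBounded_of_isCompact_toWeakSpace {C : Set E}
    (hC : IsCompact (toWeakSpace 𝕜 E '' C)) : Bornology.IsBounded C := by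
  obtain ⟨M, hM⟩ := banach_steinhaus (𝕜 := 𝕜) (𝕜₂ := 𝕜) (σ₁₂ := RingHom.id 𝕜)
    (E := StrongDual 𝕜 E) (F := 𝕜)
    (g := fun x : C => NormedSpace.inclusionInDoubleDual 𝕜 E x) (by
      intro f
      have hb := (hC.image (continuous_strongDual_toWeakSpace_symm f)).isBounded
      obtain ⟨M, hM⟩ := hb.exists_norm_le
      exact ⟨M, fun x => hM _ ⟨_, ⟨x, x.2, rfl⟩, by simp⟩⟩)
  rw [isBounded_iff_forall_norm_le]
  refine ⟨M, fun x hx => ?_⟩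
  have h := hM ⟨x, hx⟩
  have h2 := (NormedSpace.inclusionInDoubleDualLi 𝕜 (E := E)).norm_map x
  exact h2.symm.le.trans h

/-- The norm is weakly lower semicontinuous along sequences. -/
theorem eventually_lt_norm_of_tendsto_dual {v : ℕ → E} {p : E}
    (h : ∀ f : StrongDual 𝕜 E, Tendsto (fun n => f (v n)) atTop (𝓝 (f p))) {r : ℝ}
    (hr : r < ‖p‖) : ∀ᶠ n in atTop, r < ‖v n‖ := by
  obtain ⟨g, hg, hgp⟩ := exists_dual_vector'' 𝕜 p
  have h1 : Tendsto (fun n => ‖g (v n)‖) atTop (𝓝 ‖p‖) := by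
    have := (h g).norm
    rwa [hgp, RCLike.norm_ofReal, abs_of_nonneg (norm_nonneg p)] at this
  filter_upwards [h1.eventually (lt_mem_nhds hr)] with n hn
  refine hn.trans_le ((g.le_opNorm _).trans ?_)
  exact mul_le_of_le_one_left (norm_nonneg _) hg

/-- A separable subspace has a countable family of functionals that separates its points. -/
theorem exists_seq_dual_separating {F : Submodule 𝕜 E}
    (hF : TopologicalSpace.IsSeparable (F : Set E)) :
    ∃ f : ℕ → StrongDual 𝕜 E, ∀ v ∈ F, (∀ k, f k v = 0) → v = 0 := by
  obtain ⟨c, hc, hFc⟩ := hF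
  have hcne : c.Nonempty := by
    by_contra h
    rw [Set.not_nonempty_iff_eq_empty] at h
    subst h
    simpa using hFc F.zero_mem
  obtain ⟨e, he⟩ := hc.exists_eq_range hcne
  choose f hf hfe using fun k => exists_dual_vector'' 𝕜 (e k)
  refine ⟨f, fun v hv h0 => ?_⟩
  by_contra hne
  have hpos : 0 < ‖v‖ / 2 := half_pos (norm_pos_iff.2 hne)
  obtain ⟨w, hw, hvw⟩ := Metric.mem_closure_iff.1 (hFc hv) _ hpos
  rw [he] at hw
  obtain ⟨k, rfl⟩ := hw
  have h1 : ‖e k‖ ≤ ‖v - e k‖ := by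
    have : ‖f k (v - e k)‖ = ‖e k‖ := by
      rw [map_sub, h0, hfe, zero_sub, norm_neg, RCLike.norm_ofReal, abs_of_nonneg (norm_nonneg _)]
    rw [← this]
    exact ((f k).le_opNorm _).trans (mul_le_of_le_one_left (norm_nonneg _) (hf k))
  have h2 : ‖v‖ ≤ ‖v - e k‖ + ‖e k‖ := by
    simpa using norm_add_le (v - e k) (e k)
  rw [dist_eq_norm] at hvw
  linarith

/-- Weakly compact sets are weakly sequentially compact: the weak topology of the part of the set
that lies in a separable closed subspace is metrizable. -/
theorem exists_subseq_tendsto_dual [NormedSpace ℝ E] [IsScalarTower ℝ 𝕜 E] {C : Set E}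
    (hC : IsCompact (toWeakSpace 𝕜 E '' C)) {u : ℕ → E} (hu : ∀ n, u n ∈ C) :
    ∃ p ∈ C, ∃ φ : ℕ → ℕ, StrictMono φ ∧
      ∀ f : StrongDual 𝕜 E, Tendsto (fun n => f (u (φ n))) atTop (𝓝 (f p)) := by
  set F : Submodule 𝕜 E := (Submodule.span 𝕜 (Set.range u)).topologicalClosure with hFdef
  have hFsep : TopologicalSpace.IsSeparable (F : Set E) := by
    rw [hFdef, Submodule.topologicalClosure_coe]
    exact ((Set.countable_range u).isSeparable.span (R := 𝕜)).closure
  have hFcl : IsClosed (F : Set E) := Submodule.isClosed_topologicalClosure _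
  have hFconv : Convex ℝ (F : Set E) := (F.restrictScalars ℝ).convex
  obtain ⟨f, hf⟩ := exists_seq_dual_separating hFsep
  set K : Set (WeakSpace 𝕜 E) := toWeakSpace 𝕜 E '' C ∩ toWeakSpace 𝕜 E '' F with hK
  have hKc : IsCompact K := hC.inter_right (isClosed_toWeakSpace_image hFcl hFconv)
  have : CompactSpace K := isCompact_iff_compactSpace.1 hKc
  let Φ : K → ℕ → 𝕜 := fun w k => f k ((toWeakSpace 𝕜 E).symm w)
  have hΦ : Continuous Φ := continuous_pi fun k =>
    (continuous_strongDual_toWeakSpace_symm (f k)).comp continuous_subtype_val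
  have hmemF : ∀ w ∈ K, (toWeakSpace 𝕜 E).symm w ∈ F := by
    rintro _ ⟨-, v, hv, rfl⟩
    simpa using hv
  have hinj : Function.Injective Φ := by
    intro a b hab
    have h := hf ((toWeakSpace 𝕜 E).symm a - (toWeakSpace 𝕜 E).symm b)
      (F.sub_mem (hmemF _ a.2) (hmemF _ b.2)) (fun k => by
        rw [map_sub, sub_eq_zero]
        exact congrFun hab k)
    exact Subtype.ext ((toWeakSpace 𝕜 E).symm.injective (sub_eq_zero.1 h))
  have : TopologicalSpace.MetrizableSpace K :=
    (hΦ.isClosedEmbedding hinj).isEmbedding.metrizableSpace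
  have huK : ∀ n, toWeakSpace 𝕜 E (u n) ∈ K := fun n =>
    ⟨⟨_, hu n, rfl⟩, ⟨_, subset_closure (Submodule.subset_span ⟨n, rfl⟩), rfl⟩⟩
  obtain ⟨q, φ, hφ, hq⟩ := CompactSpace.tendsto_subseq fun n => (⟨_, huK n⟩ : K)
  obtain ⟨p, hp, hpq⟩ := q.2.1
  refine ⟨p, hp, φ, hφ, fun g => ?_⟩
  have h := (((continuous_strongDual_toWeakSpace_symm g).comp
    continuous_subtype_val).tendsto q).comp hq
  simpa [Function.comp_def, ← hpq] using h

end WeaklyCompact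

/-! ### Minimal invariant sets -/

/-- `C` is minimal among the nonempty closed convex sets that `T` maps into themselves. -/
structure IsMinimalInvariant {E : Type*} [NormedAddCommGroup E] [NormedSpace ℝ E] (T : E → E)
    (C : Set E) : Prop where
  nonempty : C.Nonempty
  isClosed : IsClosed C
  convex : Convex ℝ C
  mapsTo : Set.MapsTo T C C
  eq_of_subset : ∀ D ⊆ C, D.Nonempty → IsClosed D → Convex ℝ D → Set.MapsTo T D D → D = C

theorem exists_isMinimalInvariant (𝕜 : Type*) {E : Type*} [RCLike 𝕜] [NormedAddCommGroup E]
    [NormedSpace ℝ E] [NormedSpace 𝕜 E] [IsScalarTower ℝ 𝕜 E] {T : E → E} {C : Set E}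
    (hne : C.Nonempty) (hC : IsCompact (toWeakSpace 𝕜 E '' C)) (hconv : Convex ℝ C)
    (hT : Set.MapsTo T C C) : ∃ D ⊆ C, IsMinimalInvariant T D := by
  let S : Set (Set E) :=
    {D | D ⊆ C ∧ D.Nonempty ∧ IsClosed D ∧ Convex ℝ D ∧ Set.MapsTo T D D}
  have hCS : C ∈ S := ⟨subset_rfl, hne, isClosed_of_isCompact_toWeakSpace hC, hconv, hT⟩
  obtain ⟨D, hDC, hD⟩ := zorn_superset_nonempty S (by
    intro c hcS hc hcne
    refine ⟨⋂₀ c, ⟨?_, ?_, ?_, ?_, ?_⟩, fun s hs => Set.sInter_subset_of_mem hs⟩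
    · obtain ⟨D, hD⟩ := hcne
      exact (Set.sInter_subset_of_mem hD).trans (hcS hD).1
    · have : Nonempty c := hcne.to_subtype
      have h := IsCompact.nonempty_iInter_of_directed_nonempty_isCompact_isClosed
        (fun D : c => toWeakSpace 𝕜 E '' (D : Set E))
        (by
          intro A B
          rcases hc.total A.2 B.2 with h | h
          · exact ⟨A, subset_rfl, Set.image_mono h⟩
          · exact ⟨B, Set.image_mono h, subset_rfl⟩)
        (fun D => (hcS D.2).2.1.image _)
        (fun D => isCompact_toWeakSpace_of_subset hC (hcS D.2).1 (hcS D.2).2.2.1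
          (hcS D.2).2.2.2.1)
        (fun D => isClosed_toWeakSpace_image (hcS D.2).2.2.1 (hcS D.2).2.2.2.1)
      obtain ⟨w, hw⟩ := h
      refine ⟨(toWeakSpace 𝕜 E).symm w, fun D hD => ?_⟩
      obtain ⟨v, hv, rfl⟩ := Set.mem_iInter.1 hw ⟨D, hD⟩
      simpa using hv
    · exact isClosed_sInter fun D hD => (hcS hD).2.2.1
    · exact convex_sInter fun D hD => (hcS hD).2.2.2.1
    · exact fun x hx D hD => (hcS hD).2.2.2.2 (hx D hD)) C hCS
  obtain ⟨h1, h2, h3, h4, h5⟩ := hD.prop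
  refine ⟨D, h1, h2, h3, h4, h5, fun A hA hAne hAcl hAconv hAT => ?_⟩
  exact hA.antisymm (hD.le_of_le ⟨hA.trans h1, hAne, hAcl, hAconv, hAT⟩ hA)

section Nonexpansive

variable {E : Type*} [NormedAddCommGroup E] [NormedSpace ℝ E] {T : E → E} {C : Set E}

/-- Every point of a minimal invariant set is diametral: the radius of the set about a point does
not depend on the point. -/
theorem IsMinimalInvariant.forall_norm_sub_le (hC : IsMinimalInvariant T C)
    (hT : ∀ x ∈ C, ∀ y ∈ C, ‖T x - T y‖ ≤ ‖x - y‖) {s : ℝ} {z : E} (hz : z ∈ C)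
    (hzs : ∀ y ∈ C, ‖y - z‖ ≤ s) : ∀ x ∈ C, ∀ y ∈ C, ‖y - x‖ ≤ s := by
  have key : C ∩ ⋂ y ∈ C, Metric.closedBall y s = C := by
    refine hC.eq_of_subset _ Set.inter_subset_left ⟨z, hz, ?_⟩ ?_ ?_ ?_
    · simp only [Set.mem_iInter, mem_closedBall_iff_norm']
      exact hzs
    · exact hC.isClosed.inter (isClosed_biInter fun y _ => Metric.isClosed_closedBall)
    · exact hC.convex.inter (convex_iInter₂ fun y _ => convex_closedBall y s)
    · rintro x ⟨hx, hxs⟩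
      simp only [Set.mem_iInter, mem_closedBall_iff_norm'] at hxs
      -- The part of `C` within distance `s` of `T x` contains `T '' C`, so it is invariant.
      have h2 : C ∩ Metric.closedBall (T x) s = C := by
        have h3 : ∀ y ∈ C, T y ∈ C ∩ Metric.closedBall (T x) s := fun y hy =>
          ⟨hC.mapsTo hy, mem_closedBall_iff_norm.2 ((hT y hy x hx).trans (hxs y hy))⟩
        refine hC.eq_of_subset _ Set.inter_subset_left ⟨_, h3 x hx⟩
          (hC.isClosed.inter Metric.isClosed_closedBall)
          (hC.convex.inter (convex_closedBall _ _)) fun y hy => h3 y hy.1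
      refine ⟨hC.mapsTo hx, ?_⟩
      simp only [Set.mem_iInter, mem_closedBall_iff_norm']
      intro y hy
      rw [← h2] at hy
      exact mem_closedBall_iff_norm.1 hy.2
  intro x hx y hy
  rw [← key] at hx
  have := hx.2
  simp only [Set.mem_iInter, mem_closedBall_iff_norm'] at this
  exact this y hy

/-- The Goebel–Karlovitz lemma in a uniform form: almost fixed points in a weakly compact minimal
invariant set are almost at distance `diam C` from each given point of the set. -/
theorem IsMinimalInvariant.exists_forall_lt_norm_sub (𝕜 : Type*) [RCLike 𝕜] [NormedSpace 𝕜 E]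
    [IsScalarTower ℝ 𝕜 E] (hC : IsMinimalInvariant T C)
    (hcpt : IsCompact (toWeakSpace 𝕜 E '' C))
    (hT : ∀ x ∈ C, ∀ y ∈ C, ‖T x - T y‖ ≤ ‖x - y‖) {z : E} (hz : z ∈ C) {s : ℝ}
    (hs : s < Metric.diam C) : ∃ δ > 0, ∀ u ∈ C, ‖T u - u‖ < δ → s < ‖u - z‖ := by
  by_contra! hcon
  choose! u huC hTu hus using fun n : ℕ => hcon (1 / ((n : ℝ) + 1)) (by positivity)
  have hlim : Tendsto (fun n : ℕ => 1 / ((n : ℝ) + 1)) atTop (𝓝 0) :=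
    tendsto_one_div_add_atTop_nhds_zero_nat
  -- The points whose asymptotic distance from `u` is at most `s` form an invariant set.
  have key : {x ∈ C | ∀ η > 0, ∀ᶠ n in atTop, ‖u n - x‖ ≤ s + η} = C := by
    refine hC.eq_of_subset _ (Set.sep_subset _ _)
      ⟨z, hz, fun η hη => Eventually.of_forall fun n => (hus n).trans (by linarith)⟩ ?_ ?_ ?_
    · refine isClosed_of_closure_subset fun x hx => ?_
      refine ⟨closure_minimal (Set.sep_subset _ _) hC.isClosed hx, fun η hη => ?_⟩
      obtain ⟨y, hy, hxy⟩ := Metric.mem_closure_iff.1 hx (η / 2) (half_pos hη)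
      filter_upwards [hy.2 (η / 2) (half_pos hη)] with n hn
      rw [dist_eq_norm'] at hxy
      have := norm_add_le (u n - y) (y - x)
      rw [sub_add_sub_cancel] at this
      linarith
    · intro x hx y hy a b ha hb hab
      refine ⟨hC.convex hx.1 hy.1 ha hb hab, fun η hη => ?_⟩
      filter_upwards [hx.2 η hη, hy.2 η hη] with n h1 h2
      have h3 := (convex_closedBall (u n) (s + η)) (mem_closedBall_iff_norm'.2 h1)
        (mem_closedBall_iff_norm'.2 h2) ha hb hab
      exact mem_closedBall_iff_norm'.1 h3
    · intro x hx
      refine ⟨hC.mapsTo hx.1, fun η hη => ?_⟩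
      filter_upwards [hx.2 (η / 2) (half_pos hη), hlim.eventually (gt_mem_nhds (half_pos hη))]
        with n h1 h2
      have h3 := norm_add_le (u n - T (u n)) (T (u n) - T x)
      rw [sub_add_sub_cancel] at h3
      linarith [hT _ (huC n) _ hx.1, hTu n, norm_sub_rev (u n) (T (u n))]
  set r := (s + Metric.diam C) / 2 with hr
  have hball : ∀ x ∈ C, ∀ᶠ n in atTop, u n ∈ Metric.closedBall x r := by
    intro x hx
    rw [← key] at hx
    filter_upwards [hx.2 ((Metric.diam C - s) / 2) (by linarith)] with n hn
    rw [mem_closedBall_iff_norm]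
    linarith
  have hne := hcpt.inter_iInter_nonempty
    (fun x : C => toWeakSpace 𝕜 E '' Metric.closedBall (x : E) r)
    (fun x => isClosed_toWeakSpace_image Metric.isClosed_closedBall (convex_closedBall _ _))
    (fun t => by
      obtain ⟨n, hn⟩ := ((Filter.eventually_all_finset t).2 fun x _ => hball x x.2).exists
      exact ⟨toWeakSpace 𝕜 E (u n), ⟨_, huC n, rfl⟩,
        Set.mem_iInter₂.2 fun x hx => ⟨_, hn x hx, rfl⟩⟩)
  obtain ⟨_, ⟨q, hq, rfl⟩, hqr⟩ := hne
  have hq2 : ∀ x ∈ C, ‖x - q‖ ≤ r := by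
    intro x hx
    obtain ⟨q', hq', he⟩ := Set.mem_iInter.1 hqr ⟨x, hx⟩
    rw [(toWeakSpace 𝕜 E).injective he] at hq'
    exact mem_closedBall_iff_norm'.1 hq'
  have h1 := hC.forall_norm_sub_le hT hq hq2
  have hr0 : 0 ≤ r := (norm_nonneg _).trans (hq2 q hq)
  have h2 : Metric.diam C ≤ r := Metric.diam_le_of_forall_dist_le hr0 fun x hx y hy => by
    rw [dist_eq_norm]
    exact h1 y hy x hx
  linarith

/-- The equation `w = (1 - t) • T w + t • p` is solvable in `C`, for `0 < t < 1` and `p ∈ C`. -/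
theorem exists_eq_convexCombination [CompleteSpace E] (hcl : IsClosed C) (hconv : Convex ℝ C)
    (hmaps : Set.MapsTo T C C) (hT : ∀ x ∈ C, ∀ y ∈ C, ‖T x - T y‖ ≤ ‖x - y‖) {t : ℝ}
    (ht0 : 0 < t) (ht1 : t < 1) {p : E} (hp : p ∈ C) :
    ∃ w ∈ C, w = (1 - t) • T w + t • p := by
  have hm : Set.MapsTo (fun w => (1 - t) • T w + t • p) C C := fun w hw =>
    hconv (hmaps hw) hp (by linarith) ht0.le (by ring)
  have hcontr : ContractingWith (Real.toNNReal (1 - t)) (hm.restrict _ C C) := by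
    refine ⟨Real.toNNReal_lt_one.2 (by linarith), LipschitzWith.of_dist_le_mul ?_⟩
    rintro ⟨x, hx⟩ ⟨y, hy⟩
    rw [Subtype.dist_eq, Subtype.dist_eq, dist_eq_norm, dist_eq_norm]
    simp only [Set.MapsTo.val_restrict_apply, add_sub_add_right_eq_sub, ← smul_sub]
    rw [norm_smul, Real.norm_of_nonneg (by linarith), Real.coe_toNNReal _ (by linarith)]
    exact mul_le_mul_of_nonneg_left (hT x hx y hy) (by linarith)
  obtain ⟨w, hw, hfix, -⟩ := hcontr.exists_fixedPoint' hcl.isComplete hm hp (edist_ne_top _ _)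
  exact ⟨w, hw, hfix.symm⟩

theorem norm_sub_le_of_eq_convexCombination (hT : ∀ x ∈ C, ∀ y ∈ C, ‖T x - T y‖ ≤ ‖x - y‖)
    {t : ℝ} (ht0 : 0 < t) (ht1 : t < 1) {p q v w : E} (hv : v ∈ C) (hw : w ∈ C)
    (hvp : v = (1 - t) • T v + t • p) (hwq : w = (1 - t) • T w + t • q) :
    ‖v - w‖ ≤ ‖p - q‖ := by
  have h1 : v - w = (1 - t) • (T v - T w) + t • (p - q) := by
    conv_lhs => rw [hvp, hwq]
    module
  have h2 : ‖v - w‖ ≤ (1 - t) * ‖v - w‖ + t * ‖p - q‖ := by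
    calc ‖v - w‖ = ‖(1 - t) • (T v - T w) + t • (p - q)‖ := by rw [← h1]
      _ ≤ ‖(1 - t) • (T v - T w)‖ + ‖t • (p - q)‖ := norm_add_le _ _
      _ = (1 - t) * ‖T v - T w‖ + t * ‖p - q‖ := by
        rw [norm_smul, norm_smul, Real.norm_of_nonneg ht0.le, Real.norm_of_nonneg (by linarith)]
      _ ≤ _ := by
        have := mul_le_mul_of_nonneg_left (hT v hv w hw) (by linarith : 0 ≤ 1 - t)
        linarith
  exact le_of_mul_le_mul_left (by linarith) ht0

/-- A solution `w` of `w = (1 - t) • T w + t • p` stays close to `x` if `x` is almost fixed. -/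
theorem norm_sub_le_add_of_eq_convexCombination
    (hT : ∀ x ∈ C, ∀ y ∈ C, ‖T x - T y‖ ≤ ‖x - y‖) {t : ℝ} (ht0 : 0 < t) (ht1 : t < 1)
    {p w x : E} (hw : w ∈ C) (hx : x ∈ C) (hwp : w = (1 - t) • T w + t • p) :
    ‖w - x‖ ≤ ‖p - x‖ + ‖T x - x‖ / t := by
  have h1 : w - x = (1 - t) • ((T w - T x) + (T x - x)) + t • (p - x) := by
    conv_lhs => rw [hwp]
    module
  have h2 : ‖w - x‖ ≤ (1 - t) * (‖w - x‖ + ‖T x - x‖) + t * ‖p - x‖ := by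
    calc ‖w - x‖ = ‖(1 - t) • ((T w - T x) + (T x - x)) + t • (p - x)‖ := by rw [← h1]
      _ ≤ ‖(1 - t) • ((T w - T x) + (T x - x))‖ + ‖t • (p - x)‖ := norm_add_le _ _
      _ = (1 - t) * ‖(T w - T x) + (T x - x)‖ + t * ‖p - x‖ := by
        rw [norm_smul, norm_smul, Real.norm_of_nonneg ht0.le, Real.norm_of_nonneg (by linarith)]
      _ ≤ _ := by
        have := mul_le_mul_of_nonneg_left ((norm_add_le (T w - T x) (T x - x)).trans
          (add_le_add_left (hT w hw x hx) _)) (by linarith : 0 ≤ 1 - t)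
        linarith
  have h3 : t * (‖T x - x‖ / t) = ‖T x - x‖ := by field_simp
  refine le_of_mul_le_mul_left ?_ ht0
  nlinarith [norm_nonneg (T x - x)]

theorem norm_apply_sub_self_le_of_eq_convexCombination (hb : Bornology.IsBounded C)
    (hmaps : Set.MapsTo T C C) {t : ℝ} (ht0 : 0 < t) {p w : E} (hp : p ∈ C) (hw : w ∈ C)
    (hwp : w = (1 - t) • T w + t • p) : ‖T w - w‖ ≤ t * Metric.diam C := by
  have h1 : T w - w = t • (T w - p) := by
    nth_rewrite 2 [hwp]
    module
  rw [h1, norm_smul, Real.norm_of_nonneg ht0.le, ← dist_eq_norm]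
  exact mul_le_mul_of_nonneg_left (Metric.dist_le_diam_of_mem hb (hmaps hw) hp) ht0.le

/-- Almost fixed points exist. -/
theorem exists_norm_apply_sub_self_lt [CompleteSpace E] (hcl : IsClosed C) (hconv : Convex ℝ C)
    (hne : C.Nonempty) (hb : Bornology.IsBounded C)
    (hmaps : Set.MapsTo T C C) (hT : ∀ x ∈ C, ∀ y ∈ C, ‖T x - T y‖ ≤ ‖x - y‖) {δ : ℝ}
    (hδ : 0 < δ) : ∃ u ∈ C, ‖T u - u‖ < δ := by
  obtain ⟨p, hp⟩ := hne
  have hd : 0 ≤ Metric.diam C := Metric.diam_nonneg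
  set t := min (1 / 2) (δ / (2 * (Metric.diam C + 1))) with ht
  have ht0 : 0 < t := by positivity
  have ht1 : t < 1 := (min_le_left _ _).trans_lt (by norm_num)
  obtain ⟨w, hw, hwp⟩ := exists_eq_convexCombination hcl hconv hmaps hT ht0 ht1 hp
  refine ⟨w, hw, (norm_apply_sub_self_le_of_eq_convexCombination hb hmaps ht0 hp hw hwp).trans_lt ?_⟩
  have h1 : t * (2 * (Metric.diam C + 1)) ≤ δ := by
    rw [← le_div_iff₀ (by positivity)]
    exact min_le_right _ _
  nlinarith

end Nonexpansive

/-! ### The direct sum -/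

section DirectSum

variable (Z : StrictlyMonotoneNorm)

theorem StrictlyMonotoneNorm.continuous : Continuous Z.toSeminorm :=
  continuousOn_univ.1 (Z.toSeminorm.convexOn.continuousOn isOpen_univ)

theorem StrictlyMonotoneNorm.smul (c a b : ℝ) (hc : 0 ≤ c) :
    Z.toSeminorm (c * a, c * b) = c * Z.toSeminorm (a, b) := by
  have h := map_smul_eq_mul Z.toSeminorm c (a, b)
  rwa [Prod.smul_mk, smul_eq_mul, smul_eq_mul, Real.norm_of_nonneg hc] at h

theorem StrictlyMonotoneNorm.pos_left : 0 < Z.toSeminorm (1, 0) :=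
  (apply_nonneg Z.toSeminorm (0, 0)).trans_lt
    (Z.strictMono_left 0 1 0 0 le_rfl one_pos le_rfl le_rfl)

theorem StrictlyMonotoneNorm.pos_right : 0 < Z.toSeminorm (0, 1) :=
  (apply_nonneg Z.toSeminorm (0, 0)).trans_lt
    (Z.strictMono_right 0 0 0 1 le_rfl le_rfl le_rfl one_pos)

variable {Z}
variable {𝕜 X Y : Type*} [RCLike 𝕜] [NormedAddCommGroup X] [NormedSpace 𝕜 X]
  [NormedAddCommGroup Y] [NormedSpace 𝕜 Y]

namespace ZSum

theorem norm_fst_le (v : ZSum Z X Y) : ‖v.1‖ ≤ (Z.toSeminorm (1, 0))⁻¹ * ‖v‖ := by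
  rw [← div_eq_inv_mul, le_div_iff₀ Z.pos_left, ← Z.smul _ _ _ (norm_nonneg v.1), mul_one, mul_zero]
  exact Z.mono (norm_nonneg _) le_rfl le_rfl (norm_nonneg _)

theorem norm_snd_le (v : ZSum Z X Y) : ‖v.2‖ ≤ (Z.toSeminorm (0, 1))⁻¹ * ‖v‖ := by
  rw [← div_eq_inv_mul, le_div_iff₀ Z.pos_right, ← Z.smul _ _ _ (norm_nonneg v.2), mul_one,
    mul_zero]
  exact Z.mono le_rfl (norm_nonneg _) (norm_nonneg _) le_rfl

variable (Z 𝕜 X Y)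

/-- The projection of `X ⊕_Z Y` onto `X`. -/
noncomputable def fstL : ZSum Z X Y →L[𝕜] X :=
  LinearMap.mkContinuous ⟨⟨fun v => v.1, fun _ _ => rfl⟩, fun _ _ => rfl⟩ _ norm_fst_le

/-- The projection of `X ⊕_Z Y` onto `Y`. -/
noncomputable def sndL : ZSum Z X Y →L[𝕜] Y :=
  LinearMap.mkContinuous ⟨⟨fun v => v.2, fun _ _ => rfl⟩, fun _ _ => rfl⟩ _ norm_snd_le

variable {Z 𝕜 X Y}

theorem isScalarTower [NormedSpace ℝ X] [IsScalarTower ℝ 𝕜 X] [NormedSpace ℝ Y]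
    [IsScalarTower ℝ 𝕜 Y] : IsScalarTower ℝ 𝕜 (ZSum Z X Y) :=
  inferInstanceAs (IsScalarTower ℝ 𝕜 (X × Y))

theorem completeSpace (Z : StrictlyMonotoneNorm) (𝕜 X Y : Type*) [RCLike 𝕜]
    [NormedAddCommGroup X] [NormedSpace 𝕜 X] [NormedAddCommGroup Y] [NormedSpace 𝕜 Y]
    [CompleteSpace X] [CompleteSpace Y] : CompleteSpace (ZSum Z X Y) := by
  refine Metric.complete_of_cauchySeq_tendsto fun u hu => ?_
  obtain ⟨x, hx⟩ := cauchySeq_tendsto_of_complete ((fstL Z 𝕜 X Y).uniformContinuous.comp_cauchySeq hu)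
  obtain ⟨y, hy⟩ := cauchySeq_tendsto_of_complete ((sndL Z 𝕜 X Y).uniformContinuous.comp_cauchySeq hu)
  refine ⟨(x, y), tendsto_iff_norm_sub_tendsto_zero.2 ?_⟩
  have h := (Z.continuous.tendsto (0, 0)).comp
    ((tendsto_iff_norm_sub_tendsto_zero.1 hx).prodMk_nhds
      (tendsto_iff_norm_sub_tendsto_zero.1 hy))
  have h0 : Z.toSeminorm (0, 0) = 0 := map_zero Z.toSeminorm
  rw [h0] at h
  exact h

end ZSum

/-! ### Vanishing of the second component -/

/-- A weakly null sequence whose norms converge to `b` and whose terms are eventually at distance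
at most about `b` from each other has a subsequence of asymptotic diameter `b`. So property
asymptotic (P) leaves only `b = 0`. -/
theorem HasPropertyAsymptoticP.eq_zero_of_tendsto_norm (hY : HasPropertyAsymptoticP 𝕜 Y)
    {y : ℕ → Y} (hnull : IsWeaklyNull 𝕜 y) {b : ℝ} (hb : Tendsto (fun n => ‖y n‖) atTop (𝓝 b))
    (hdist : ∀ ε > 0, ∃ M, ∀ m ≥ M, ∀ᶠ n in atTop, ‖y n - y m‖ < b + ε) : b = 0 := by
  by_contra hne
  have hb0 : 0 < b := (ge_of_tendsto' hb fun n => norm_nonneg _).lt_of_ne' hne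
  choose M hM using fun k : ℕ => hdist (1 / ((k : ℝ) + 1)) (by positivity)
  -- Choose pairs `(k, m)` one after another: `k` carries the tolerance `1 / (k + 1)`.
  obtain ⟨g, hgP, hg⟩ := exists_seq_of_forall_finset_exists
    (fun q : ℕ × ℕ => M q.1 ≤ q.2)
    (fun q q' => q.1 < q'.1 ∧ q.2 < q'.2 ∧ ‖y q'.2 - y q.2‖ < b + 1 / ((q.1 : ℝ) + 1)) (by
      intro s hs
      obtain ⟨k, hk⟩ : ∃ k, ∀ q ∈ s, q.1 < k :=
        ((Filter.eventually_all_finset s).2 fun q _ => eventually_gt_atTop q.1).exists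
      obtain ⟨m, hm, hmM⟩ := (((Filter.eventually_all_finset s).2 fun q hq =>
        (eventually_gt_atTop q.2).and (hM q.1 q.2 (hs q hq))).and (eventually_ge_atTop (M k))).exists
      exact ⟨(k, m), hmM, fun q hq => ⟨hk q hq, (hm q hq).1, (hm q hq).2⟩⟩)
  have hmono1 : StrictMono fun i => (g i).1 := fun i j hij => (hg i j hij).1
  have hmono2 : StrictMono fun i => (g i).2 := fun i j hij => (hg i j hij).2.1
  set x : ℕ → Y := fun i => y (g i).2 with hx
  have hxnull : IsWeaklyNull 𝕜 x := fun f => (hnull f).comp hmono2.tendsto_atTop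
  have hxnorm : Tendsto (fun n => ‖x n‖) atTop (𝓝 b) := hb.comp hmono2.tendsto_atTop
  have hlt : ∀ n i j, n ≤ i → i < j → ‖x j - x i‖ ≤ b + 1 / ((n : ℝ) + 1) := by
    intro n i j hni hij
    refine (hg i j hij).2.2.le.trans ?_
    have : (n : ℝ) ≤ (g i).1 := by exact_mod_cast hni.trans (hmono1.le_apply)
    gcongr
  have hle : ∀ n, ∀ p ∈ x '' Set.Ici n, ∀ q ∈ x '' Set.Ici n,
      dist p q ≤ b + 1 / ((n : ℝ) + 1) := by
    rintro n _ ⟨i, hi, rfl⟩ _ ⟨j, hj, rfl⟩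
    rcases lt_trichotomy i j with h | rfl | h
    · rw [dist_eq_norm']
      exact hlt n i j hi h
    · rw [dist_self]
      positivity
    · rw [dist_eq_norm]
      exact hlt n j i hj h
  have hdiam : IsAsymptoticDiam x b := by
    refine tendsto_of_tendsto_of_tendsto_of_le_of_le (g := fun _ => b)
      (h := fun n : ℕ => b + 1 / ((n : ℝ) + 1)) tendsto_const_nhds
      (by simpa using tendsto_one_div_add_atTop_nhds_zero_nat.const_add b) ?_ ?_
    · intro n
      have hbdd : Bornology.IsBounded (x '' Set.Ici n) :=
        Metric.isBounded_iff.2 ⟨_, fun p hp q hq => hle n p hp q hq⟩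
      refine le_of_tendsto hxnorm ?_
      filter_upwards [eventually_ge_atTop n] with m hm
      -- `x m - x k` converges weakly to `x m`, so its norm is at least about `‖x m‖`.
      by_contra! hcon
      have h1 := eventually_lt_norm_of_tendsto_dual (𝕜 := 𝕜) (v := fun k => x m - x k) (p := x m)
        (fun f => by simpa using (hxnull f).const_sub (f (x m))) hcon
      obtain ⟨k, hk, hkn⟩ := (h1.and (eventually_ge_atTop n)).exists
      rw [← dist_eq_norm] at hk
      exact hk.not_ge (Metric.dist_le_diam_of_mem hbdd ⟨m, hm, rfl⟩ ⟨k, hkn, rfl⟩)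
    · intro n
      exact Metric.diam_le_of_forall_dist_le (by positivity) (hle n)
  have h := hY x hxnull b hdiam hb0
  rw [hxnorm.liminf_eq] at h
  exact h.false

/-- If a weakly null sequence in `X ⊕_Z Y` has mutual distances at most the limit `d` of its norms,
then its second components tend to `0` along a subsequence. The distances of the first components
are asymptotically at least `lim ‖(v n).1‖`, so strict monotonicity keeps the distances of the
second components from exceeding `lim ‖(v n).2‖`. -/
theorem ZSum.exists_subseq_tendsto_snd (hY : HasPropertyAsymptoticP 𝕜 Y) {v : ℕ → ZSum Z X Y}
    (hnull : IsWeaklyNull 𝕜 v) {d : ℝ} (hd : Tendsto (fun n => ‖v n‖) atTop (𝓝 d))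
    (hdist : ∀ n m, ‖v n - v m‖ ≤ d) :
    ∃ φ : ℕ → ℕ, StrictMono φ ∧ Tendsto (fun n => ‖(v (φ n)).2‖) atTop (𝓝 0) := by
  obtain ⟨B, hB⟩ := hd.bddAbove_range
  have hB' : ∀ n, ‖v n‖ ≤ B := fun n => hB ⟨n, rfl⟩
  obtain ⟨⟨a, b⟩, -, φ, hφ, hab⟩ := tendsto_subseq_of_bounded
    (s := Set.Icc (0 : ℝ) ((Z.toSeminorm (1, 0))⁻¹ * B) ×ˢ
      Set.Icc (0 : ℝ) ((Z.toSeminorm (0, 1))⁻¹ * B))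
    ((Metric.isBounded_Icc _ _).prod (Metric.isBounded_Icc _ _))
    (x := fun n => (‖(v n).1‖, ‖(v n).2‖)) (fun n =>
      ⟨⟨norm_nonneg _, (norm_fst_le _).trans
        (mul_le_mul_of_nonneg_left (hB' n) (inv_nonneg.2 Z.pos_left.le))⟩,
       ⟨norm_nonneg _, (norm_snd_le _).trans
        (mul_le_mul_of_nonneg_left (hB' n) (inv_nonneg.2 Z.pos_right.le))⟩⟩)
  have ha : Tendsto (fun n => ‖(v (φ n)).1‖) atTop (𝓝 a) := (continuous_fst.tendsto _).comp hab
  have hb : Tendsto (fun n => ‖(v (φ n)).2‖) atTop (𝓝 b) := (continuous_snd.tendsto _).comp hab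
  have hZ : Z.toSeminorm (a, b) = d :=
    tendsto_nhds_unique ((Z.continuous.tendsto _).comp hab) (hd.comp hφ.tendsto_atTop)
  have ha0 : 0 ≤ a := ge_of_tendsto' ha fun n => norm_nonneg _
  have hb0 : 0 ≤ b := ge_of_tendsto' hb fun n => norm_nonneg _
  have hnullX : IsWeaklyNull 𝕜 fun n => (v (φ n)).1 := fun f =>
    (hnull (f.comp (fstL Z 𝕜 X Y))).comp hφ.tendsto_atTop
  have hnullY : IsWeaklyNull 𝕜 fun n => (v (φ n)).2 := fun f =>
    (hnull (f.comp (sndL Z 𝕜 X Y))).comp hφ.tendsto_atTop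
  have hbzero : b = 0 := by
    refine hY.eq_zero_of_tendsto_norm hnullY hb fun ε hε => ?_
    have hgt : d < Z.toSeminorm (max (a - 0) 0, b + ε) := by
      rw [sub_zero, max_eq_left ha0, ← hZ]
      exact Z.strictMono_right _ _ _ _ ha0 le_rfl hb0 (by linarith)
    have hcont : Continuous fun η : ℝ => Z.toSeminorm (max (a - η) 0, b + ε) :=
      Z.continuous.comp (by fun_prop)
    obtain ⟨η, hη, hη0⟩ := (((hcont.tendsto 0).eventually (lt_mem_nhds hgt)).filter_mono
      nhdsWithin_le_nhds |>.and (self_mem_nhdsWithin (s := Set.Ioi (0 : ℝ)))).exists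
    have hη0 : 0 < η := hη0
    obtain ⟨M, hM⟩ := eventually_atTop.1 (ha.eventually (lt_mem_nhds (sub_lt_self a hη0)))
    refine ⟨M, fun m hm => ?_⟩
    filter_upwards [eventually_lt_norm_of_tendsto_dual (𝕜 := 𝕜)
      (v := fun n => (v (φ n)).1 - (v (φ m)).1) (p := -(v (φ m)).1)
      (fun f => by simpa using (hnullX f).sub_const (f (v (φ m)).1))
      (by rw [norm_neg]; exact hM m hm)] with n hn
    by_contra! hcon
    refine (hη.trans_le ?_).not_ge (hdist (φ n) (φ m))
    exact Z.mono (le_max_right _ _) (max_le hn.le (norm_nonneg _)) (by linarith) hcon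
  exact ⟨φ, hφ, hbzero ▸ hb⟩

end DirectSum

/-! ### Coordinate projections of a `1`-unconditional basis -/

section Basis

variable {𝕜 X : Type*} [RCLike 𝕜] [NormedAddCommGroup X] [NormedSpace 𝕜 X]
  {b : SchauderBasis 𝕜 X}

/-- Changing the signs of finitely many coordinates does not increase the norm. -/
theorem IsUnconditionalConstant.norm_sub_two_smul_proj_le (hb : IsUnconditionalConstant b 1)
    (A : Finset ℕ) (x : X) : ‖x - (2 : 𝕜) • GeneralSchauderBasis.proj b A x‖ ≤ ‖x‖ := by
  classical
  rcases eq_or_ne x 0 with rfl | hx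
  · simp
  have hx0 : 0 < ‖x‖ := norm_pos_iff.2 hx
  set c : 𝕜 := ((‖x‖⁻¹ : ℝ) : 𝕜) with hc
  have hcn : ‖c‖ = ‖x‖⁻¹ := by
    rw [hc, RCLike.norm_ofReal, abs_of_nonneg (inv_nonneg.2 hx0.le)]
  set ε : ℕ → 𝕜 := fun i => if i ∈ A then -1 else 1 with hε
  have h1 := b.expansion (c • x)
  have h2 : HasSum (fun i => if i ∈ A then (2 : 𝕜) • b.coord i (c • x) • b i else 0)
      (∑ i ∈ A, if i ∈ A then (2 : 𝕜) • b.coord i (c • x) • b i else 0)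
      (SummationFilter.conditional ℕ) :=
    hasSum_sum_of_ne_finset_zero fun i hi => if_neg hi
  have h3 : HasSum (fun i => ε i • b.coord i (c • x) • b i)
      (c • x - (2 : 𝕜) • GeneralSchauderBasis.proj b A (c • x))
      (SummationFilter.conditional ℕ) := by
    convert h1.sub h2 using 1
    · funext i
      by_cases hi : i ∈ A
      · simp only [hε, if_pos hi]
        module
      · simp only [hε, if_neg hi]
        module
    · rw [GeneralSchauderBasis.proj_apply, Finset.smul_sum]
      congr 1
      exact Finset.sum_congr rfl fun i hi => (if_pos hi).symm
  have h4 : ‖c • x - (2 : 𝕜) • GeneralSchauderBasis.proj b A (c • x)‖ ≤ 1 := by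
    refine hb.1 ⟨ε, fun i => b.coord i (c • x), c • x, _, fun i => ?_, h1, ?_, h3, rfl⟩
    · by_cases hi : i ∈ A
      · exact Or.inr (if_pos hi)
      · exact Or.inl (if_neg hi)
    · rw [norm_smul, hcn, inv_mul_cancel₀ hx0.ne']
  rw [map_smul, smul_comm (2 : 𝕜) c, ← smul_sub, norm_smul, hcn, inv_mul_le_iff₀ hx0,
    mul_one] at h4
  exact h4

theorem IsUnconditionalConstant.norm_proj_le (hb : IsUnconditionalConstant b 1)
    (A : Finset ℕ) (x : X) : ‖GeneralSchauderBasis.proj b A x‖ ≤ ‖x‖ := by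
  have h1 : ‖(2 : 𝕜) • GeneralSchauderBasis.proj b A x‖ = 2 * ‖GeneralSchauderBasis.proj b A x‖ := by
    rw [norm_smul, RCLike.norm_two]
  have h2 := norm_sub_le x (x - (2 : 𝕜) • GeneralSchauderBasis.proj b A x)
  rw [sub_sub_cancel, h1] at h2
  linarith [hb.norm_sub_two_smul_proj_le A x]

theorem IsUnconditionalConstant.norm_sub_proj_le (hb : IsUnconditionalConstant b 1)
    (A : Finset ℕ) (x : X) : ‖x - GeneralSchauderBasis.proj b A x‖ ≤ ‖x‖ := by
  have h1 : ‖(2 : 𝕜) • (x - GeneralSchauderBasis.proj b A x)‖ =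
      2 * ‖x - GeneralSchauderBasis.proj b A x‖ := by
    rw [norm_smul, RCLike.norm_two]
  have h2 := norm_add_le x (x - (2 : 𝕜) • GeneralSchauderBasis.proj b A x)
  have h3 : x + (x - (2 : 𝕜) • GeneralSchauderBasis.proj b A x) =
      (2 : 𝕜) • (x - GeneralSchauderBasis.proj b A x) := by module
  rw [h3, h1] at h2
  linarith [hb.norm_sub_two_smul_proj_le A x]

theorem IsUnconditionalConstant.norm_add_le_norm_sub_add (hb : IsUnconditionalConstant b 1)
    {N : ℕ} {x y : X} {ε : ℝ} (hx : ‖x - b.proj N x‖ ≤ ε) (hy : ‖b.proj N y‖ ≤ ε) :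
    ‖x + y‖ ≤ ‖x - y‖ + 4 * ε := by
  have h1 := hb.norm_sub_two_smul_proj_le (Finset.range N) (x - y)
  change ‖x - y - (2 : 𝕜) • b.proj N (x - y)‖ ≤ _ at h1
  have h2 : x + y = -(x - y - (2 : 𝕜) • b.proj N (x - y)) +
      ((2 : 𝕜) • (x - b.proj N x) + (2 : 𝕜) • b.proj N y) := by
    rw [map_sub]
    module
  rw [h2]
  refine (norm_add_le _ _).trans ?_
  rw [norm_neg]
  have h3 := norm_add_le ((2 : 𝕜) • (x - b.proj N x)) ((2 : 𝕜) • b.proj N y)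
  rw [norm_smul, norm_smul, RCLike.norm_two] at h3
  linarith

/-- Let `P` and `Q` be the coordinate projections onto `[M, N)` and `[N, ∞)`. If `x` almost lies in
the range of `P`, `y` in that of `Q`, and `z` in the common kernel, then `2 ‖w‖` is bounded through
`2 w = (P + Q) w + (w - P w) + (w - Q w)`. -/
theorem IsUnconditionalConstant.two_mul_norm_le (hb : IsUnconditionalConstant b 1)
    {M N : ℕ} (hMN : M ≤ N) {x y z : X} {ε : ℝ} (hz : ‖z - b.proj M z‖ ≤ ε)
    (hxM : ‖b.proj M x‖ ≤ ε) (hxN : ‖x - b.proj N x‖ ≤ ε) (hy : ‖b.proj N y‖ ≤ ε) (w : X) :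
    2 * ‖w‖ ≤ ‖w - z‖ + ‖w - x‖ + ‖w - y‖ + 4 * ε := by
  have hP : ∀ v, GeneralSchauderBasis.proj b (Finset.range N \ Finset.range M) v =
      b.proj N v - b.proj M v := by
    intro v
    simp only [SchauderBasis.proj, GeneralSchauderBasis.proj_apply]
    rw [eq_sub_iff_add_eq]
    exact Finset.sum_sdiff (Finset.range_mono hMN)
  have h1 : ‖w - z - b.proj M (w - z)‖ ≤ ‖w - z‖ := hb.norm_sub_proj_le (Finset.range M) (w - z)
  have h2 := hb.norm_sub_proj_le (Finset.range N \ Finset.range M) (w - x)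
  rw [hP] at h2
  have h3 : ‖b.proj N (w - y)‖ ≤ ‖w - y‖ := hb.norm_proj_le (Finset.range N) (w - y)
  have h4 : (2 : 𝕜) • w = ((w - z - b.proj M (w - z)) + (z - b.proj M z)) +
      ((w - x - (b.proj N (w - x) - b.proj M (w - x))) + (x - b.proj N x) + b.proj M x) +
      (b.proj N (w - y) + b.proj N y) := by
    simp only [map_sub]
    module
  have h5 : 2 * ‖w‖ = ‖(2 : 𝕜) • w‖ := by rw [norm_smul, RCLike.norm_two]
  rw [h5, h4]
  refine (norm_add₃_le).trans ?_
  linarith [norm_add_le (w - z - b.proj M (w - z)) (z - b.proj M z),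
    norm_add₃_le (a := w - x - (b.proj N (w - x) - b.proj M (w - x))) (b := x - b.proj N x)
      (c := b.proj M x), norm_add_le (b.proj N (w - y)) (b.proj N y)]

variable {Z : StrictlyMonotoneNorm} {Y : Type*} [NormedAddCommGroup Y]

theorem ZSum.norm_add_le_norm_sub_add (hb : IsUnconditionalConstant b 1)
    {N : ℕ} {x y : ZSum Z X Y} {ε : ℝ} (hx : ‖x.1 - b.proj N x.1‖ ≤ ε)
    (hy : ‖b.proj N y.1‖ ≤ ε) (hy2 : ‖y.2‖ ≤ ε) :
    ‖x + y‖ ≤ ‖x - y‖ + ε * Z.toSeminorm (4, 4) := by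
  have hε : 0 ≤ ε := (norm_nonneg _).trans hy2
  rw [← Z.smul _ _ _ hε]
  refine le_trans ?_ (map_add_le_add Z.toSeminorm (‖(x - y).1‖, ‖(x - y).2‖) (ε * 4, ε * 4))
  refine Z.mono (norm_nonneg _) ?_ (norm_nonneg _) ?_
  · have := hb.norm_add_le_norm_sub_add hx hy
    change ‖x.1 + y.1‖ ≤ ‖x.1 - y.1‖ + ε * 4
    linarith
  · change ‖x.2 + y.2‖ ≤ ‖x.2 - y.2‖ + ε * 4
    have h1 := norm_add₃_le (a := x.2 - y.2) (b := y.2) (c := y.2)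
    rw [sub_add_cancel] at h1
    linarith

theorem ZSum.two_mul_norm_le (hb : IsUnconditionalConstant b 1)
    {M N : ℕ} (hMN : M ≤ N) {x y z : ZSum Z X Y} {ε : ℝ} (hz : ‖z.1 - b.proj M z.1‖ ≤ ε)
    (hxM : ‖b.proj M x.1‖ ≤ ε) (hxN : ‖x.1 - b.proj N x.1‖ ≤ ε) (hy : ‖b.proj N y.1‖ ≤ ε)
    (hx2 : ‖x.2‖ ≤ ε) (hy2 : ‖y.2‖ ≤ ε) (w : ZSum Z X Y) :
    2 * ‖w‖ ≤ ‖w - z‖ + ‖w - x‖ + ‖w - y‖ + ε * Z.toSeminorm (4, 4) := by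
  have hε : 0 ≤ ε := (norm_nonneg _).trans hy2
  rw [norm_def, ← Z.smul _ _ _ hε, ← Z.smul _ _ _ zero_le_two]
  have h1 : Z.toSeminorm (‖(w - z).1‖ + ‖(w - x).1‖ + ‖(w - y).1‖ + ε * 4,
      ‖(w - z).2‖ + ‖(w - x).2‖ + ‖(w - y).2‖ + ε * 4) ≤
      ‖w - z‖ + ‖w - x‖ + ‖w - y‖ + Z.toSeminorm (ε * 4, ε * 4) :=
    (map_add_le_add Z.toSeminorm (‖(w - z).1‖ + ‖(w - x).1‖ + ‖(w - y).1‖,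
      ‖(w - z).2‖ + ‖(w - x).2‖ + ‖(w - y).2‖) (ε * 4, ε * 4)).trans
      (add_le_add_left ((map_add_le_add Z.toSeminorm (‖(w - z).1‖ + ‖(w - x).1‖,
        ‖(w - z).2‖ + ‖(w - x).2‖) (‖(w - y).1‖, ‖(w - y).2‖)).trans
        (add_le_add_left (map_add_le_add Z.toSeminorm (‖(w - z).1‖, ‖(w - z).2‖)
          (‖(w - x).1‖, ‖(w - x).2‖)) _)) _)
  refine le_trans (Z.mono (by positivity) ?_ (by positivity) ?_) h1
  · have := hb.two_mul_norm_le hMN hz hxM hxN hy w.1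
    change 2 * ‖w.1‖ ≤ ‖w.1 - z.1‖ + ‖w.1 - x.1‖ + ‖w.1 - y.1‖ + ε * 4
    linarith
  · change 2 * ‖w.2‖ ≤ ‖w.2 - z.2‖ + ‖w.2 - x.2‖ + ‖w.2 - y.2‖ + ε * 4
    have h2 := norm_add_le (w.2 - x.2) x.2
    have h3 := norm_add_le (w.2 - y.2) y.2
    rw [sub_add_cancel] at h2 h3
    linarith [norm_nonneg (w.2 - z.2)]

end Basis

/-! ### Minimal invariant sets in the direct sum -/

section Main

variable {𝕜 X Y : Type*} [RCLike 𝕜]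
  [NormedAddCommGroup X] [NormedSpace ℝ X] [NormedSpace 𝕜 X] [IsScalarTower ℝ 𝕜 X]
  [NormedAddCommGroup Y] [NormedSpace ℝ Y] [NormedSpace 𝕜 Y] [IsScalarTower ℝ 𝕜 Y]
  {Z : StrictlyMonotoneNorm} {T : ZSum Z X Y → ZSum Z X Y} {C : Set (ZSum Z X Y)}

/-- A weakly compact minimal invariant set of a nonexpansive map contains a weakly convergent
sequence of almost fixed points whose second components converge in norm. -/
theorem ZSum.exists_almostFixed_seq [CompleteSpace X] [CompleteSpace Y]
    (hY : HasPropertyAsymptoticP 𝕜 Y)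
    (hC : IsMinimalInvariant T C) (hcpt : IsCompact (toWeakSpace 𝕜 (ZSum Z X Y) '' C))
    (hT : ∀ x ∈ C, ∀ y ∈ C, ‖T x - T y‖ ≤ ‖x - y‖) :
    ∃ p ∈ C, ∃ u : ℕ → ZSum Z X Y, (∀ n, u n ∈ C) ∧
      Tendsto (fun n => ‖T (u n) - u n‖) atTop (𝓝 0) ∧
      IsWeaklyNull 𝕜 (fun n => u n - p) ∧
      Tendsto (fun n => ‖(u n - p).2‖) atTop (𝓝 0) := by
  have := ZSum.isScalarTower (Z := Z) (𝕜 := 𝕜) (X := X) (Y := Y)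
  have := ZSum.completeSpace Z 𝕜 X Y
  have hbdd := isBounded_of_isCompact_toWeakSpace hcpt
  choose u huC hTu using fun n : ℕ => exists_norm_apply_sub_self_lt hC.isClosed hC.convex
    hC.nonempty hbdd hC.mapsTo hT (δ := 1 / ((n : ℝ) + 1)) (by positivity)
  have hTu0 : Tendsto (fun n => ‖T (u n) - u n‖) atTop (𝓝 0) :=
    squeeze_zero (fun n => norm_nonneg _) (fun n => (hTu n).le)
      tendsto_one_div_add_atTop_nhds_zero_nat
  obtain ⟨p, hp, φ, hφ, hφp⟩ := exists_subseq_tendsto_dual hcpt huC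
  have hnull : IsWeaklyNull 𝕜 (fun n => u (φ n) - p) := fun f => by
    simpa using (hφp f).sub_const (f p)
  have hdist : ∀ x ∈ C, ∀ y ∈ C, ‖x - y‖ ≤ Metric.diam C := fun x hx y hy => by
    rw [← dist_eq_norm]
    exact Metric.dist_le_diam_of_mem hbdd hx hy
  have hnorm : Tendsto (fun n => ‖u (φ n) - p‖) atTop (𝓝 (Metric.diam C)) := by
    refine tendsto_order.2 ⟨fun s hs => ?_, fun s hs => ?_⟩
    · obtain ⟨δ, hδ, h⟩ := hC.exists_forall_lt_norm_sub 𝕜 hcpt hT hp hs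
      filter_upwards [(hTu0.comp hφ.tendsto_atTop).eventually (gt_mem_nhds hδ)] with n hn
      exact h _ (huC _) hn
    · exact Eventually.of_forall fun n => (hdist _ (huC _) _ hp).trans_lt hs
  obtain ⟨ψ, hψ, h2⟩ := ZSum.exists_subseq_tendsto_snd hY hnull hnorm fun n m => by
    rw [sub_sub_sub_cancel_right]
    exact hdist _ (huC _) _ (huC _)
  exact ⟨p, hp, fun n => u (φ (ψ n)), fun n => huC _,
    hTu0.comp (hφ.comp hψ).tendsto_atTop, fun f => (hnull f).comp hψ.tendsto_atTop, h2⟩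

/-- A weakly compact minimal invariant set of a nonexpansive map is a single point: otherwise `w`
below is an almost fixed point at distance about `3 / 4 * d` from `p`, against Goebel–Karlovitz. -/
theorem ZSum.diam_eq_zero_of_isMinimalInvariant [CompleteSpace X] [CompleteSpace Y]
    {b : SchauderBasis 𝕜 X} (hb : IsUnconditionalConstant b 1)
    (hY : HasPropertyAsymptoticP 𝕜 Y)
    (hC : IsMinimalInvariant T C) (hcpt : IsCompact (toWeakSpace 𝕜 (ZSum Z X Y) '' C))
    (hT : ∀ x ∈ C, ∀ y ∈ C, ‖T x - T y‖ ≤ ‖x - y‖) : Metric.diam C = 0 := by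
  have := ZSum.isScalarTower (Z := Z) (𝕜 := 𝕜) (X := X) (Y := Y)
  have := ZSum.completeSpace Z 𝕜 X Y
  have hbdd := isBounded_of_isCompact_toWeakSpace hcpt
  by_contra hne
  set d := Metric.diam C with hd_def
  have hd : 0 < d := Metric.diam_nonneg.lt_of_ne' hne
  have hdist : ∀ x ∈ C, ∀ y ∈ C, ‖x - y‖ ≤ d := fun x hx y hy => by
    rw [← dist_eq_norm]
    exact Metric.dist_le_diam_of_mem hbdd hx hy
  obtain ⟨p, hp, u, huC, hTu, hnull, hsnd⟩ := ZSum.exists_almostFixed_seq hY hC hcpt hT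
  obtain ⟨δ, hδ, hGK⟩ := hC.exists_forall_lt_norm_sub 𝕜 hcpt hT hp
    (s := 7 / 8 * d) (by linarith)
  set t := min (1 / 2) (δ / (2 * d)) with ht
  have ht0 : 0 < t := by positivity
  have ht1 : t < 1 := (min_le_left _ _).trans_lt (by norm_num)
  have htd : t * d < δ := by
    have : t * (2 * d) ≤ δ := by
      rw [← le_div_iff₀ (by positivity)]
      exact min_le_right _ _
    linarith
  set κ := Z.toSeminorm (4, 4) with hκ
  have hκ0 : 0 ≤ κ := apply_nonneg Z.toSeminorm _
  set ε := d / (4 * (2 + 2 * κ)) with hε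
  have hε0 : 0 < ε := by positivity
  have hεκ : ε * (2 + 2 * κ) = d / 4 := by
    rw [hε]
    field_simp
  -- The pieces of the estimate: `z` solves the perturbed equation at `p`, and `u n`, `u m` are
  -- chosen so that the first components of `u n - p` and `u m - p` are almost supported on
  -- consecutive blocks of coordinates on which that of `z - p` is small.
  obtain ⟨z, hz, hzp⟩ := exists_eq_convexCombination hC.isClosed hC.convex hC.mapsTo hT ht0 ht1 hp
  obtain ⟨M, hM⟩ := ((tendsto_iff_norm_sub_tendsto_zero.1 (b.tendsto_proj (z - p).1)).eventually
    (gt_mem_nhds hε0)).exists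
  have hproj : ∀ k, Tendsto (fun n => ‖b.proj k (u n - p).1‖) atTop (𝓝 0) := by
    intro k
    have h : Tendsto (fun n => b.proj k (u n - p).1) atTop (𝓝 0) := by
      simp only [SchauderBasis.proj_apply]
      rw [← Finset.sum_const_zero (s := Finset.range k)]
      refine tendsto_finsetSum _ fun i _ => ?_
      have := (hnull ((b.coord i).comp (fstL Z 𝕜 X Y))).smul_const (b i)
      rwa [zero_smul] at this
    simpa using h.norm
  have hev : ∀ᶠ n in atTop, ‖(u n - p).2‖ < ε ∧ ‖T (u n) - u n‖ < ε * t :=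
    (hsnd.eventually (gt_mem_nhds hε0)).and
      (hTu.eventually (gt_mem_nhds (mul_pos hε0 ht0)))
  obtain ⟨n, ⟨hn2, hnT⟩, hnM⟩ :=
    (hev.and ((hproj M).eventually (gt_mem_nhds hε0))).exists
  obtain ⟨N, hN, hMN⟩ :=
    (((tendsto_iff_norm_sub_tendsto_zero.1 (b.tendsto_proj (u n - p).1)).eventually
      (gt_mem_nhds hε0)).and (eventually_ge_atTop M)).exists
  obtain ⟨m, ⟨hm2, hmT⟩, hmN⟩ :=
    (hev.and ((hproj N).eventually (gt_mem_nhds hε0))).exists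
  rw [norm_sub_rev] at hM hN
  have hqC : (1 / 2 : ℝ) • u n + (1 / 2 : ℝ) • u m ∈ C :=
    hC.convex (huC n) (huC m) (by norm_num) (by norm_num) (by norm_num)
  obtain ⟨w, hw, hwq⟩ :=
    exists_eq_convexCombination hC.isClosed hC.convex hC.mapsTo hT ht0 ht1 hqC
  have hnm := hdist _ (huC n) _ (huC m)
  have hhalf : ∀ v : ZSum Z X Y, ‖(1 / 2 : ℝ) • v‖ = ‖v‖ / 2 := fun v => by
    rw [norm_smul, Real.norm_of_nonneg (by norm_num)]
    ring
  have hwz : ‖w - z‖ ≤ (d + ε * κ) / 2 := by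
    refine (norm_sub_le_of_eq_convexCombination hT ht0 ht1 hw hz hwq hzp).trans ?_
    have h1 : (1 / 2 : ℝ) • u n + (1 / 2 : ℝ) • u m - p = (1 / 2 : ℝ) • ((u n - p) + (u m - p)) := by
      module
    have h2 := ZSum.norm_add_le_norm_sub_add hb hN.le hmN.le hm2.le
    rw [sub_sub_sub_cancel_right] at h2
    rw [h1, hhalf]
    linarith
  have hdiv : ∀ {s : ℝ}, s < ε * t → s / t ≤ ε := fun h => ((div_lt_iff₀ ht0).2 h).le
  have hwn : ‖w - u n‖ ≤ d / 2 + ε := by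
    refine (norm_sub_le_add_of_eq_convexCombination hT ht0 ht1 hw (huC n) hwq).trans ?_
    have h1 : (1 / 2 : ℝ) • u n + (1 / 2 : ℝ) • u m - u n = -((1 / 2 : ℝ) • (u n - u m)) := by
      module
    rw [h1, norm_neg, hhalf]
    linarith [hdiv hnT]
  have hwm : ‖w - u m‖ ≤ d / 2 + ε := by
    refine (norm_sub_le_add_of_eq_convexCombination hT ht0 ht1 hw (huC m) hwq).trans ?_
    have h1 : (1 / 2 : ℝ) • u n + (1 / 2 : ℝ) • u m - u m = (1 / 2 : ℝ) • (u n - u m) := by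
      module
    rw [h1, hhalf]
    linarith [hdiv hmT]
  have hwp := ZSum.two_mul_norm_le hb hMN hM.le hnM.le hN.le hmN.le hn2.le hm2.le (w - p)
  simp only [sub_sub_sub_cancel_right] at hwp
  have hfix : ‖T w - w‖ < δ :=
    (norm_apply_sub_self_le_of_eq_convexCombination hbdd hC.mapsTo ht0 hqC hw hwq).trans_lt htd
  have hfar := hGK w hw hfix
  have hεκ0 : 0 ≤ ε * κ := by positivity
  linarith

end Main

theorem theorem2 {𝕜 : Type*} [RCLike 𝕜] {X Y : Type*}
    [NormedAddCommGroup X] [NormedSpace ℝ X] [NormedSpace 𝕜 X] [IsScalarTower ℝ 𝕜 X]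
    [CompleteSpace X]
    [NormedAddCommGroup Y] [NormedSpace ℝ Y] [NormedSpace 𝕜 Y] [IsScalarTower ℝ 𝕜 Y]
    [CompleteSpace Y]
    (hX : HasOneUnconditionalBasis 𝕜 X) (hY : HasPropertyAsymptoticP 𝕜 Y)
    (Z : StrictlyMonotoneNorm) :
    HasWeakFixedPointProperty 𝕜 (ZSum Z X Y) := by
  classical
  intro C hne hcpt hconv T hT
  obtain ⟨b, -, hb⟩ := hX
  have := ZSum.isScalarTower (Z := Z) (𝕜 := 𝕜) (X := X) (Y := Y)
  set S : ZSum Z X Y → ZSum Z X Y := fun x => if h : x ∈ C then T ⟨x, h⟩ else x with hS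
  have hSC : ∀ x (h : x ∈ C), S x = T ⟨x, h⟩ := fun x h => dif_pos h
  have hmaps : Set.MapsTo S C C := fun x hx => by
    rw [hSC x hx]
    exact (T ⟨x, hx⟩).2
  have hnonexp : ∀ x ∈ C, ∀ y ∈ C, ‖S x - S y‖ ≤ ‖x - y‖ := fun x hx y hy => by
    rw [hSC x hx, hSC y hy]
    simpa [Subtype.dist_eq, dist_eq_norm] using hT.dist_le_mul ⟨x, hx⟩ ⟨y, hy⟩
  obtain ⟨D, hDC, hD⟩ := exists_isMinimalInvariant 𝕜 hne hcpt hconv hmaps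
  have hDcpt := isCompact_toWeakSpace_of_subset hcpt hDC hD.isClosed hD.convex
  have hdiam := ZSum.diam_eq_zero_of_isMinimalInvariant hb hY hD hDcpt
    fun x hx y hy => hnonexp x (hDC hx) y (hDC hy)
  obtain ⟨x, hx⟩ := hD.nonempty
  refine ⟨⟨x, hDC hx⟩, Subtype.ext ?_⟩
  rw [← hSC x (hDC hx)]
  refine dist_le_zero.1 (hdiam ▸ ?_)
  exact Metric.dist_le_diam_of_mem (isBounded_of_isCompact_toWeakSpace hDcpt) (hD.mapsTo hx) hx
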